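/- A dispatcher with a memory serves $N\ge 1$ parallel servers, each with an infinite FIFO queue, in discrete time. In each time slot $A_\Sigma(t)\in\mathbb{N}$ tasks arrive and server $n$ offers $S_n(t)\in\mathbb{N}$ units of service; arrivals and services are i.i.d. over time, independent of each other and across servers, and bounded: $A_\Sigma(t)\le A_{\max}$, $S_n(t)\le S_{\max}$. Let $\mu_n=\mathbb{E}[S_n(t)]>0$ and $\mu_\Sigma=\sum_n\mu_n$. The service laws are fixed; in the system with parameter $\epsilon>0$ the arrival law satisfies $\mathbb{P}(A_\Sigma(t)=0)>0$ and $\mathbb{E}[A_\Sigma(t)]=\mu_\Sigma-\epsilon$, where $A_{\max}$ does not depend on $\epsilon$. Under Join-Below-Threshold (JBT) with threshold $r\ge1$, all the arrivals of a slot go to one server. If the memory $m(t)$ (a set of server IDs) is non-empty, server $i\in m(t)$ is chosen with probability $\mu_i/\sum_{j\in m(t)}\mu_j$; if it is empty, server $i$ is chosen with probability $\mu_i/\mu_\Sigma$. When there is at least one arrival, the ID of the chosen server is removed from the memory (if it is there). Then $Q_n(t+1)=\max(Q_n(t)+A_n(t)-S_n(t),0)$, where $A_n(t)$ is the number of arrivals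 sent to server $n$, and every server with $Q_n(t+1)<r$ whose ID is not in memory sends its ID to the memory. The chain $Z(t)=(\mathbf{Q}(t),m(t))$ starts with empty queues and all IDs in memory, and its state space is the set of the states that can be reached from there. Then, for every threshold $r\ge1$, JBT is throughput optimal: for every $\epsilon>0$ the chain is irreducible and positive recurrent, so that it has a unique stationary distribution, and all moments of $\|\overline{\mathbf{Q}}^{(\epsilon)}\|$ (the Euclidean norm of the queue length vector in steady state) are finite. Moreover: (i) for every integer $p\ge1$ there is a constant $M_p>0$, independent of $\epsilon$, of $r$ and of the arrival law, such that $\mathbb{E}\big[\|\overline{\mathbf{Q}}^{(\epsilon)}\|^p\big]\le M_p/\epsilon^p$ for all $\epsilon>0$ and $r\ge 1$; (ii) there are constants $c,K_1,K_2>0$, independent of $\epsilon$, of $r$ and of the arrival law, such that $\mathbb{E}\big[e^{\theta^*\|\overline{\mathbf{Q}}^{(\epsilon)}\|}\big]\le K_1e^{\theta^*K_2/\epsilon}$ for all $\epsilon>0$, all $r\ge1$ and all $\theta^*\in(0,c\,\epsilon]$. -/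

import Mathlib

open scoped ENNReal

noncomputable section

namespace JBT

/-! ### Discrete-time Markov chains on a countable state space -/

section MarkovChain

variable {α : Type*}

/-- `Reaches P x y`: the chain with transition law `P` goes from `x` to `y` in finitely many
(possibly zero) steps with positive probability. -/
def Reaches (P : α → PMF α) : α → α → Prop :=
  Relation.ReflTransGen fun x y => P x y ≠ 0

open Classical in
/-- The probability that the chain started at `x` is not in the state `z` at any of the
times `1, …, k`. -/
def avoidProb (P : α → PMF α) (z : α) : ℕ → α → ℝ≥0∞
  | 0, _ => 1
  | k + 1, x => ∑' y, P x y * (if y = z then 0 else avoidProb P z k y)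

/-- The expected first return time `E_z[τ_z] = ∑_{k ≥ 0} P_z(τ_z > k)`,
`τ_z = min {t ≥ 1 | Z(t) = z}`. -/
def meanReturnTime (P : α → PMF α) (z : α) : ℝ≥0∞ :=
  ∑' k, avoidProb P z k z

/-- The chain started at `z₀`, whose state space is the set of the states that can be reached
from `z₀`, is irreducible and positive recurrent. -/
structure IsPositiveRecurrent (P : α → PMF α) (z₀ : α) : Prop where
  irreducible : ∀ x y, Reaches P z₀ x → Reaches P z₀ y → Reaches P x y
  meanReturnTime_lt_top : ∀ z, Reaches P z₀ z → meanReturnTime P z < ⊤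

/-- `π` is a stationary distribution of the chain. -/
def IsStationary (P : α → PMF α) (π : PMF α) : Prop :=
  π.bind P = π

/-- The expectation of `f ≥ 0` under `π`, as an extended nonnegative number. -/
def expect (π : PMF α) (f : α → ℝ) : ℝ≥0∞ :=
  ∑' z, π z * ENNReal.ofReal (f z)

end MarkovChain

/-! ### The load balancing system under Join-Below-Threshold -/

/-- The mean of a law on `ℕ` (it is used for laws of finite support only). -/
def mean (p : PMF ℕ) : ℝ :=
  ∑' k, (p k).toReal * k

/-- A state `(Q, m)`: the vector of queue lengths at the beginning of a time slot and the set of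
the server IDs in the memory of the dispatcher. -/
abbrev State (N : ℕ) : Type :=
  (Fin N → ℕ) × Finset (Fin N)

variable {N : ℕ}

/-- The Euclidean norm of the queue length vector. -/
def queueNorm (z : State N) : ℝ :=
  ‖(WithLp.toLp 2 fun n => (z.1 n : ℝ) : EuclideanSpace ℝ (Fin N))‖

/-- The joint law of the services `(S_1, …, S_N)` offered in a time slot: the product of
the marginal laws. -/
def serviceLaw (svc : Fin N → PMF ℕ) : PMF (Fin N → ℕ) :=
  (MeasureTheory.Measure.pi fun n => (svc n).toMeasure).toPMF

/-- The servers among which the dispatcher chooses: the ones in memory, or all the servers when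
the memory is empty. -/
def candidates (m : Finset (Fin N)) : Finset (Fin N) :=
  if m.Nonempty then m else Finset.univ

/-- Weight `μ_n` for each candidate `n`, weight `0` for every other server. -/
def routeWeight (svc : Fin N → PMF ℕ) (m : Finset (Fin N)) (n : Fin N) : ℝ≥0∞ :=
  if n ∈ candidates m then ENNReal.ofReal (mean (svc n)) else 0

theorem tsum_routeWeight_ne_zero [NeZero N] {svc : Fin N → PMF ℕ}
    (hμ : ∀ n, 0 < mean (svc n)) (m : Finset (Fin N)) :
    ∑' n, routeWeight svc m n ≠ 0 := by
  obtain ⟨n, hn⟩ : (candidates m).Nonempty := by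
    unfold candidates
    split_ifs with h
    · exact h
    · exact Finset.univ_nonempty
  intro h
  have h' := ENNReal.tsum_eq_zero.mp h n
  simp only [routeWeight, hn, if_true, ENNReal.ofReal_eq_zero] at h'
  exact absurd (hμ n) (not_lt.mpr h')

theorem tsum_routeWeight_ne_top (svc : Fin N → PMF ℕ) (m : Finset (Fin N)) :
    ∑' n, routeWeight svc m n ≠ ⊤ := by
  rw [tsum_fintype]
  refine ENNReal.sum_ne_top.mpr fun n _ => ?_
  unfold routeWeight
  split_ifs <;> simp

/-- The law of the server to which the arrivals of a time slot are sent: each candidate is chosen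
with a probability proportional to its service rate (so uniformly if the servers are
homogeneous). -/
def route [NeZero N] (svc : Fin N → PMF ℕ) (hμ : ∀ n, 0 < mean (svc n))
    (m : Finset (Fin N)) : PMF (Fin N) :=
  PMF.normalize (routeWeight svc m) (tsum_routeWeight_ne_zero hμ m)
    (tsum_routeWeight_ne_top svc m)

/-- The queue lengths after a time slot with `a` arrivals sent to server `n` and offered
services `s`. The subtraction is the truncated one of `ℕ`, so this is
`Q + A - S + U = max (Q + A - S) 0` with unused service `U = max (S - Q - A) 0`. -/
def nextQueue (Q : Fin N → ℕ) (a : ℕ) (n : Fin N) (s : Fin N → ℕ) : Fin N → ℕ :=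
  fun i => (Q i + if i = n then a else 0) - s i

open Classical in
/-- The memory after a time slot which ends with queue lengths `Q'`: if there was an arrival, the
ID of the chosen server has been removed; then each server whose queue length is below the
threshold and whose ID is not in memory sends its ID. -/
def nextMemory (r : ℝ) (m : Finset (Fin N)) (a : ℕ) (n : Fin N) (Q' : Fin N → ℕ) :
    Finset (Fin N) :=
  (if a = 0 then m else m.erase n) ∪ Finset.univ.filter fun i => (Q' i : ℝ) < r

/-- The state after a time slot with `a` arrivals sent to server `n` and offered services `s`. -/
def nextState (r : ℝ) (z : State N) (a : ℕ) (n : Fin N) (s : Fin N → ℕ) : State N :=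
  (nextQueue z.1 a n s, nextMemory r z.2 a n (nextQueue z.1 a n s))

/-- The transition law of the chain `Z(t) = (Q(t), m(t))` under JBT with threshold `r`, when in each
time slot the total number of arrivals has law `arr`, the service offered by server `n` has law
`svc n`, and arrivals, services and routing decision are independent given the state. -/
def jbtChain [NeZero N] (r : ℝ) (arr : PMF ℕ) (svc : Fin N → PMF ℕ)
    (hμ : ∀ n, 0 < mean (svc n)) (z : State N) : PMF (State N) :=
  arr.bind fun a => (route svc hμ z.2).bind fun n =>
    (serviceLaw svc).bind fun s => PMF.pure (nextState r z a n s)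

/-- The initial state: all queues are empty and all IDs are in memory. -/
def emptyState (N : ℕ) : State N :=
  (fun _ => 0, Finset.univ)

/-- The assumptions on the arrival law of the system with parameter `ε`: at most `Amax` arrivals
per time slot, none with positive probability, and mean `λ = ∑ n, μ_n - ε`. -/
structure IsArrivalLaw (svc : Fin N → PMF ℕ) (Amax : ℕ) (ε : ℝ) (arr : PMF ℕ) : Prop where
  le_max : ∀ k ∈ arr.support, k ≤ Amax
  zero_mem : 0 ∈ arr.support
  mean_eq : mean arr = ∑ n, mean (svc n) - ε

end JBT

end

/-!
In a reachable state the memory holds exactly the servers below the threshold `r`, that is, an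
initial segment of the servers in the order of their queue lengths. So, whatever `r` is, the mean
queue length seen by an arrival, `∑ p_n Q_n`, is at most the one under random routing with
probabilities `μ_n / μ_Σ` (`JBT.candidates_average_le`). Hence `‖Q‖²` has the drift
`≤ K - 2 κ ‖Q‖`, where `κ` is proportional to `ε` and `κ` and `K` do not depend on `r`.

Take `f = √(‖Q‖² + B²)` with `B = K / (2 κ)`. This smoothed norm has bounded increments, its drift
is at most `K / f - κ` by concavity of the square root, and `K / f ≤ 2 κ` everywhere, also
near `Q = 0`. For `θ` at most a constant times `ε`, this gives a geometric drift
`E[e^{θ f'}] ≤ (1 - δ) e^{θ f} + δ C` with `δ = θ κ / 4` and `C = 7 e^{4 θ K / κ}`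
(`JBT.exp_mul_le_of_drift`). Without the smoothing, the constant term would not be of order `δ`, and
`K₁` would grow as `ε → 0`. Since `e^{θ f} ≤ C` in the empty state, `E[e^{θ f(Z(t))}] ≤ C` at all
times (`JBT.tsum_stepLaw_exp_le`).

These bounds make the Cesàro means of the laws of `Z(t)` tight, and a limit along an ultrafilter is
a stationary distribution that inherits them (`JBT.exists_isStationary`). The empty state can be
reached from everywhere (`JBT.reaches_emptyState`), so every stationary distribution charges it,
there is only one (`JBT.IsStationary.unique`), and it charges all reachable states; finite mean
return times follow from `π(z) E_z[τ_z] ≤ 1` (`JBT.IsStationary.mul_meanReturnTime_le`). The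
polynomial moments come from the exponential one at the largest admissible `θ`.
-/

noncomputable section

namespace JBT

/-! ### Markov chains on a countable state space -/

section Chain

open Filter Topology

variable {α : Type*} {P : α → PMF α} {z₀ z : α}

theorem tsum_bind_mul {β : Type*} (p : PMF α) (q : α → PMF β) (g : β → ℝ≥0∞) :
    ∑' y, (p.bind q) y * g y = ∑' x, p x * ∑' y, q x y * g y := by
  simp_rw [PMF.bind_apply, ← ENNReal.tsum_mul_right, ← ENNReal.tsum_mul_left, mul_assoc]
  exact ENNReal.tsum_comm

theorem tsum_pure_mul {β : Type*} (x : β) (g : β → ℝ≥0∞) :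
    ∑' y, PMF.pure x y * g y = g x := by
  rw [tsum_eq_single x]
  · simp
  · intro y hy
    simp [PMF.pure_apply, hy]

theorem tsum_tsum_mul_eq (P : α → PMF α) (ν : α → ℝ≥0∞) :
    ∑' y, ∑' x, ν x * P x y = ∑' x, ν x := by
  rw [ENNReal.tsum_comm]
  simp_rw [ENNReal.tsum_mul_left, PMF.tsum_coe, mul_one]

/-- A finite measure which is subinvariant is invariant, since one step of the chain preserves
the total mass. -/
theorem invariant_of_subinvariant {ν : α → ℝ≥0∞} (hν : ∑' x, ν x ≠ ⊤)
    (h : ∀ y, ∑' x, ν x * P x y ≤ ν y) (y : α) : ∑' x, ν x * P x y = ν y := by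
  by_contra hne
  have hlt : ∑' x, ν x * P x y < ν y := lt_of_le_of_ne (h y) hne
  have := ENNReal.tsum_lt_tsum (by rwa [tsum_tsum_mul_eq P ν]) h hlt
  rw [tsum_tsum_mul_eq P ν] at this
  exact lt_irrefl _ this

theorem invariant_ne_zero_of_reaches {ν : α → ℝ≥0∞} (h : ∀ y, ∑' x, ν x * P x y = ν y)
    {x y : α} (hxy : Reaches P x y) (hx : ν x ≠ 0) : ν y ≠ 0 := by
  induction hxy with
  | refl => exact hx
  | tail _ hbc ih =>
    rw [← h]
    intro h0
    exact mul_ne_zero ih hbc (ENNReal.tsum_eq_zero.mp h0 _)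

theorem IsStationary.tsum_mul_eq {π : PMF α} (hπ : IsStationary P π) (y : α) :
    ∑' x, π x * P x y = π y := by
  rw [← PMF.bind_apply, hπ]

theorem IsStationary.apply_ne_zero {π : PMF α} (hπ : IsStationary P π)
    (hz : ∀ x, Reaches P x z) : π z ≠ 0 := by
  obtain ⟨x, hx⟩ := π.support_nonempty
  exact invariant_ne_zero_of_reaches hπ.tsum_mul_eq (hz x) ((PMF.mem_support_iff _ _).1 hx)

/-- The part of a stationary distribution which exceeds another one is an invariant measure. -/
theorem IsStationary.tsum_tsub_mul_eq {π π' : PMF α} (hπ : IsStationary P π)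
    (hπ' : IsStationary P π') (y : α) : ∑' x, (π x - π' x) * P x y = π y - π' y := by
  have hle : ∑' x, min (π x) (π' x) ≤ 1 :=
    (ENNReal.tsum_le_tsum fun x => min_le_left _ _).trans π.tsum_coe.le
  have hmin := invariant_of_subinvariant (P := P) (ν := fun x => min (π x) (π' x))
    (ne_top_of_le_ne_top ENNReal.one_ne_top hle) (fun y => le_min
      ((ENNReal.tsum_le_tsum fun x => mul_le_mul_left (min_le_left _ _) _).trans_eq
        (hπ.tsum_mul_eq y))
      ((ENNReal.tsum_le_tsum fun x => mul_le_mul_left (min_le_right _ _) _).trans_eq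
        (hπ'.tsum_mul_eq y))) y
  have hsplit : ∀ x, (π x - π' x) + min (π x) (π' x) = π x := fun x => by
    rcases le_total (π x) (π' x) with h | h
    · rw [tsub_eq_zero_of_le h, min_eq_left h, zero_add]
    · rw [min_eq_right h, tsub_add_cancel_of_le h]
  have hsum : ∑' x, (π x - π' x) * P x y + min (π y) (π' y) = π y := by
    rw [← hmin, ← ENNReal.tsum_add, ← hπ.tsum_mul_eq y]
    exact tsum_congr fun x => by rw [← add_mul, hsplit]
  have htop : min (π y) (π' y) ≠ ⊤ := ne_top_of_le_ne_top (π.apply_ne_top y) (min_le_left _ _)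
  exact (ENNReal.add_left_inj htop).1 (hsum.trans (hsplit y).symm)

theorem pmf_eq_of_le {π π' : PMF α} (h : ∀ x, π x ≤ π' x) : π = π' := by
  by_contra hne
  obtain ⟨x, hx⟩ := DFunLike.ne_iff.1 hne
  have := ENNReal.tsum_lt_tsum (by rw [π.tsum_coe]; simp) h (lt_of_le_of_ne (h x) hx)
  rw [π.tsum_coe, π'.tsum_coe] at this
  exact lt_irrefl _ this

/-- If some state can be reached from everywhere, there is at most one stationary distribution:
otherwise both `π - π'` and `π' - π` would charge that state. -/
theorem IsStationary.unique {π π' : PMF α} (hz : ∀ x, Reaches P x z) (hπ : IsStationary P π)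
    (hπ' : IsStationary P π') : π' = π := by
  have key : ∀ {σ τ : PMF α}, IsStationary P σ → IsStationary P τ → σ ≠ τ → τ z < σ z := by
    intro σ τ hσ hτ hne
    have : ∃ x, σ x - τ x ≠ 0 := by
      by_contra! h0
      exact hne (pmf_eq_of_le fun x => tsub_eq_zero_iff_le.1 (h0 x))
    obtain ⟨x, hx⟩ := this
    have := invariant_ne_zero_of_reaches (hσ.tsum_tsub_mul_eq hτ) (hz x) hx
    exact tsub_pos_iff_lt.1 (pos_iff_ne_zero.2 this)
  by_contra hne
  exact lt_asymm (key hπ' hπ hne) (key hπ hπ' (Ne.symm hne))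

/-- Half of Kac's formula: `π z * E_z[τ_z] ≤ 1`. By stationarity, the probability that the
stationary chain avoids `z` at the times `1, …, k` drops by `π z * P_z(τ_z > k)` when `k` is
replaced by `k + 1`. -/
theorem IsStationary.mul_meanReturnTime_le {π : PMF α} (hπ : IsStationary P π) (z : α) :
    π z * meanReturnTime P z ≤ 1 := by
  have hstep : ∀ k, ∑' x, π x * avoidProb P z (k + 1) x + π z * avoidProb P z k z
      = ∑' x, π x * avoidProb P z k x := by
    intro k
    classical
    have h1 : ∑' x, π x * avoidProb P z (k + 1) x
        = ∑' y, π y * (if y = z then 0 else avoidProb P z k y) := by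
      have := tsum_bind_mul π P fun y => if y = z then 0 else avoidProb P z k y
      rw [show π.bind P = π from hπ] at this
      rw [this]
      refine tsum_congr fun x => ?_
      rw [avoidProb]
    have h2 : π z * avoidProb P z k z
        = ∑' y, π y * (if y = z then avoidProb P z k y else 0) := by
      rw [tsum_eq_single z]
      · simp
      · intro y hy
        simp [hy]
    rw [h1, h2, ← ENNReal.tsum_add]
    refine tsum_congr fun y => ?_
    split_ifs <;> simp
  have hsum : ∀ n, ∑ k ∈ Finset.range n, π z * avoidProb P z k z
      + ∑' x, π x * avoidProb P z n x = 1 := by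
    intro n
    induction n with
    | zero => simp [avoidProb]
    | succ n ih => rw [Finset.sum_range_succ, add_assoc, add_comm (π z * _), hstep, ih]
  rw [meanReturnTime, ← ENNReal.tsum_mul_left]
  refine ENNReal.tsum_le_of_sum_range_le fun n => ?_
  rw [← hsum n]
  exact le_self_add

/-- The law of the chain at time `k`, when it starts at `z₀`. -/
def stepLaw (P : α → PMF α) (z₀ : α) : ℕ → PMF α
  | 0 => PMF.pure z₀
  | k + 1 => (stepLaw P z₀ k).bind P

theorem reaches_of_stepLaw_ne_zero (k : ℕ) {x : α} (hx : stepLaw P z₀ k x ≠ 0) :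
    Reaches P z₀ x := by
  induction k generalizing x with
  | zero =>
    have : x = z₀ := by
      by_contra hne
      exact hx (by simp [stepLaw, PMF.pure_apply, hne])
    exact this ▸ Relation.ReflTransGen.refl
  | succ k ih =>
    rw [stepLaw, PMF.bind_apply] at hx
    obtain ⟨y, hy⟩ : ∃ y, stepLaw P z₀ k y * P y x ≠ 0 := by
      by_contra! h0
      exact hx (ENNReal.tsum_eq_zero.2 h0)
    exact (ih (left_ne_zero_of_mul hy)).tail (right_ne_zero_of_mul hy)

/-- A geometric drift inequality on the reachable states bounds the expectations of `f` at all
times. -/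
theorem tsum_stepLaw_mul_le {f : α → ℝ≥0∞} {γ b C : ℝ≥0∞}
    (hdrift : ∀ x, Reaches P z₀ x → ∑' y, P x y * f y ≤ γ * f x + b)
    (hC : γ * C + b ≤ C) (h₀ : f z₀ ≤ C) (k : ℕ) : ∑' x, stepLaw P z₀ k x * f x ≤ C := by
  induction k with
  | zero => rwa [stepLaw, tsum_pure_mul]
  | succ k ih =>
    rw [stepLaw, tsum_bind_mul]
    calc ∑' x, stepLaw P z₀ k x * ∑' y, P x y * f y
        ≤ ∑' x, (γ * (stepLaw P z₀ k x * f x) + stepLaw P z₀ k x * b) := by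
          refine ENNReal.tsum_le_tsum fun x => ?_
          by_cases hx : stepLaw P z₀ k x = 0
          · simp [hx]
          · calc _ ≤ stepLaw P z₀ k x * (γ * f x + b) :=
                  mul_le_mul_right (hdrift x (reaches_of_stepLaw_ne_zero k hx)) _
              _ = _ := by ring
      _ = γ * ∑' x, stepLaw P z₀ k x * f x + b := by
          rw [ENNReal.tsum_add, ENNReal.tsum_mul_left, ENNReal.tsum_mul_right, PMF.tsum_coe,
            one_mul]
      _ ≤ γ * C + b := by gcongr
      _ ≤ C := hC

/-- The mean `1 / (n + 1) * ∑ k ≤ n, P(Z(k) = x)` of the laws of the chain up to time `n`. -/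
def cesaroLaw (P : α → PMF α) (z₀ : α) (n : ℕ) (x : α) : ℝ≥0∞ :=
  ((n : ℝ≥0∞) + 1)⁻¹ * ∑ k ∈ Finset.range (n + 1), stepLaw P z₀ k x

theorem natCast_succ_inv_mul_cancel (n : ℕ) :
    ((n : ℝ≥0∞) + 1)⁻¹ * ((n : ℝ≥0∞) + 1) = 1 :=
  ENNReal.inv_mul_cancel (by simp) (by simp)

theorem tsum_cesaroLaw_mul (f : α → ℝ≥0∞) (n : ℕ) :
    ∑' x, cesaroLaw P z₀ n x * f x
      = ((n : ℝ≥0∞) + 1)⁻¹ * ∑ k ∈ Finset.range (n + 1), ∑' x, stepLaw P z₀ k x * f x := by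
  simp_rw [cesaroLaw, mul_assoc, Finset.sum_mul]
  rw [ENNReal.tsum_mul_left, Summable.tsum_finsetSum fun _ _ => ENNReal.summable]

theorem tsum_cesaroLaw_mul_le {f : α → ℝ≥0∞} {C : ℝ≥0∞}
    (h : ∀ k, ∑' x, stepLaw P z₀ k x * f x ≤ C) (n : ℕ) :
    ∑' x, cesaroLaw P z₀ n x * f x ≤ C := by
  rw [tsum_cesaroLaw_mul]
  calc _ ≤ ((n : ℝ≥0∞) + 1)⁻¹ * ∑ k ∈ Finset.range (n + 1), C := by
        gcongr with k
        exact h k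
    _ = C := by
        rw [Finset.sum_const, Finset.card_range, nsmul_eq_mul, ← mul_assoc, Nat.cast_succ,
          natCast_succ_inv_mul_cancel, one_mul]

theorem tsum_cesaroLaw (n : ℕ) : ∑' x, cesaroLaw P z₀ n x = 1 := by
  have := tsum_cesaroLaw_mul (P := P) (z₀ := z₀) (fun _ => 1) n
  simp only [mul_one, PMF.tsum_coe, Finset.sum_const, Finset.card_range, nsmul_eq_mul,
    Nat.cast_succ, natCast_succ_inv_mul_cancel] at this
  exact this

theorem tsum_cesaroLaw_mul_apply_le (n : ℕ) (y : α) :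
    ∑' x, cesaroLaw P z₀ n x * P x y ≤ cesaroLaw P z₀ n y + ((n : ℝ≥0∞) + 1)⁻¹ := by
  rw [tsum_cesaroLaw_mul, cesaroLaw]
  have : ∀ k, ∑' x, stepLaw P z₀ k x * P x y = stepLaw P z₀ (k + 1) y := fun k => by
    rw [stepLaw, PMF.bind_apply]
  simp_rw [this]
  calc _ ≤ ((n : ℝ≥0∞) + 1)⁻¹ * ∑ k ∈ Finset.range (n + 1 + 1), stepLaw P z₀ k y := by
        rw [Finset.sum_range_succ' _ (n + 1)]
        gcongr
        exact le_self_add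
    _ ≤ _ := by
        rw [Finset.sum_range_succ _ (n + 1), mul_add]
        gcongr
        exact mul_le_of_le_one_right' (PMF.coe_le_one _ _)

/-- Existence of a stationary distribution (Krylov–Bogolyubov): if the expectations of a function
`W` with finite sublevel sets are bounded along the chain, the Cesàro means of the laws are tight,
and their limit along an ultrafilter is a stationary distribution. It inherits all the
bounds on expectations which hold along the chain. -/
theorem exists_isStationary {W : α → ℝ≥0∞} (hfin : ∀ M : ℕ, {x | W x ≤ M}.Finite)
    {C : ℝ≥0∞} (hC : C ≠ ⊤) (hW : ∀ k, ∑' x, stepLaw P z₀ k x * W x ≤ C) :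
    ∃ π : PMF α, IsStationary P π ∧ ∀ (f : α → ℝ≥0∞) (C' : ℝ≥0∞), (∀ x, f x ≠ ⊤) →
      (∀ k, ∑' x, stepLaw P z₀ k x * f x ≤ C') → ∑' x, π x * f x ≤ C' := by
  let U : Ultrafilter ℕ := Filter.hyperfilter ℕ
  have hU : (U : Filter ℕ) ≤ atTop := Nat.hyperfilter_le_atTop
  obtain ⟨π, hπ⟩ : ∃ π : α → ℝ≥0∞,
      ∀ x, Tendsto (fun n => cesaroLaw P z₀ n x) U (𝓝 (π x)) := by
    refine ⟨(U.map (cesaroLaw P z₀)).lim, ?_⟩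
    exact tendsto_pi_nhds.1 (U.map (cesaroLaw P z₀)).le_nhds_lim
  have hbound : ∀ (f : α → ℝ≥0∞) (C' : ℝ≥0∞), (∀ x, f x ≠ ⊤) →
      (∀ k, ∑' x, stepLaw P z₀ k x * f x ≤ C') → ∑' x, π x * f x ≤ C' := by
    intro f C' hf hC'
    refine ENNReal.summable.tsum_le_of_sum_le fun F => ?_
    refine le_of_tendsto (tendsto_finsetSum F fun x _ =>
      ENNReal.Tendsto.mul_const (hπ x) (Or.inr (hf x))) (Eventually.of_forall fun n => ?_)
    exact (ENNReal.sum_le_tsum F).trans (tsum_cesaroLaw_mul_le hC' n)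
  have hmass_le : ∑' x, π x ≤ 1 := by
    simpa using hbound (fun _ => 1) 1 (by simp) (by simp [PMF.tsum_coe])
  have hmass_ge : ∀ M : ℕ, M ≠ 0 → 1 ≤ ∑' x, π x + C / M := by
    intro M hM
    have hM' : (M : ℝ≥0∞) ≠ 0 := by exact_mod_cast hM
    have hn : ∀ n, 1 ≤ ∑ x ∈ (hfin M).toFinset, cesaroLaw P z₀ n x + C / M := by
      intro n
      rw [← tsum_cesaroLaw (P := P) (z₀ := z₀) n]
      classical
      calc ∑' x, cesaroLaw P z₀ n x
          ≤ ∑' x, ((if x ∈ (hfin M).toFinset then cesaroLaw P z₀ n x else 0)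
              + cesaroLaw P z₀ n x * W x / M) := by
            refine ENNReal.tsum_le_tsum fun x => ?_
            split_ifs with hx
            · exact le_self_add
            · have hx' : (M : ℝ≥0∞) ≤ W x := by
                simp only [Set.Finite.mem_toFinset, Set.mem_ofPred_eq, not_le] at hx
                exact hx.le
              rw [zero_add, ENNReal.le_div_iff_mul_le (Or.inl hM') (Or.inl (by simp))]
              gcongr
        _ ≤ _ := by
            rw [ENNReal.tsum_add]
            gcongr
            · rw [tsum_eq_sum (s := (hfin M).toFinset)]
              · exact (Finset.sum_congr rfl fun x hx => by rw [if_pos hx]).le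
              · intro x hx
                rw [if_neg hx]
            · simp_rw [div_eq_mul_inv]
              rw [ENNReal.tsum_mul_right]
              gcongr
              exact tsum_cesaroLaw_mul_le hW n
    refine (ge_of_tendsto ((tendsto_finsetSum _ fun x _ => hπ x).add_const _)
      (Eventually.of_forall hn)).trans ?_
    gcongr
    exact ENNReal.sum_le_tsum _
  have hmass : ∑' x, π x = 1 := by
    refine le_antisymm hmass_le ?_
    have hlim : Tendsto (fun M : ℕ => ∑' x, π x + C / M) atTop (𝓝 (∑' x, π x + 0)) := by
      refine tendsto_const_nhds.add ?_
      have := ENNReal.Tendsto.const_mul (a := C) ENNReal.tendsto_inv_nat_nhds_zero (Or.inr hC)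
      simpa [div_eq_mul_inv] using this
    rw [add_zero] at hlim
    exact ge_of_tendsto hlim ((eventually_ne_atTop 0).mono hmass_ge)
  have hsub : ∀ y, ∑' x, π x * P x y ≤ π y := by
    intro y
    refine ENNReal.summable.tsum_le_of_sum_le fun F => ?_
    have hinv : Tendsto (fun n : ℕ => ((n : ℝ≥0∞) + 1)⁻¹) U (𝓝 0) := by
      have := (tendsto_add_atTop_iff_nat 1).2 ENNReal.tendsto_inv_nat_nhds_zero
      simp only [Nat.cast_add, Nat.cast_one] at this
      exact this.mono_left hU
    have hr := (hπ y).add hinv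
    rw [add_zero] at hr
    refine le_of_tendsto_of_tendsto (tendsto_finsetSum F fun x _ =>
      ENNReal.Tendsto.mul_const (hπ x) (Or.inr ((P x).apply_ne_top y))) hr
      (Eventually.of_forall fun n => ?_)
    exact (ENNReal.sum_le_tsum F).trans (tsum_cesaroLaw_mul_apply_le n y)
  obtain ⟨σ, rfl⟩ : ∃ σ : PMF α, ⇑σ = π := ⟨⟨π, hmass ▸ ENNReal.summable.hasSum⟩, rfl⟩
  refine ⟨σ, PMF.ext fun y => ?_, hbound⟩
  rw [PMF.bind_apply]
  exact invariant_of_subinvariant (by rw [hmass]; simp) hsub y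

/-- A chain with a stationary distribution is positive recurrent on the states that can be reached
from `z₀`, if `z₀` can be reached from everywhere. -/
theorem IsStationary.isPositiveRecurrent {π : PMF α} (hπ : IsStationary P π)
    (hz : ∀ x, Reaches P x z₀) : IsPositiveRecurrent P z₀ where
  irreducible x _ _ hy := (hz x).trans hy
  meanReturnTime_lt_top z hz' := by
    have hne : π z ≠ 0 := hπ.apply_ne_zero fun x => (hz x).trans hz'
    by_contra htop
    have := hπ.mul_meanReturnTime_le z
    rw [not_lt_top_iff.1 htop, ENNReal.mul_top hne] at this
    exact absurd this (by simp)

end Chain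

variable {N : ℕ}

/-! ### Expectations under the laws of the system -/

theorem ofReal_mean {p : PMF ℕ} {B : ℕ} (hB : ∀ k ∈ p.support, k ≤ B) :
    ENNReal.ofReal (mean p) = ∑' k, p k * k := by
  have htop : ∑' k, p k * k ≠ ⊤ := by
    refine ne_top_of_le_ne_top (b := (B : ℝ≥0∞)) (by simp) ?_
    calc ∑' k, p k * k ≤ ∑' k, p k * B := by
          refine ENNReal.tsum_le_tsum fun k => ?_
          by_cases hk : p k = 0
          · simp [hk]
          · gcongr
            exact hB k ((PMF.mem_support_iff _ _).2 hk)
      _ = B := by rw [ENNReal.tsum_mul_right, PMF.tsum_coe, one_mul]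
  have : mean p = (∑' k, p k * k).toReal := by
    rw [mean, ENNReal.tsum_toReal_eq fun k => ENNReal.mul_ne_top (p.apply_ne_top k) (by simp)]
    simp
  rw [this, ENNReal.ofReal_toReal htop]

theorem mean_nonneg (p : PMF ℕ) : 0 ≤ mean p :=
  tsum_nonneg fun _ => by positivity

theorem serviceLaw_apply (svc : Fin N → PMF ℕ) (s : Fin N → ℕ) :
    serviceLaw svc s = ∏ i, svc i (s i) := by
  rw [serviceLaw, MeasureTheory.Measure.toPMF_apply, MeasureTheory.Measure.pi_singleton]
  refine Finset.prod_congr rfl fun i _ => ?_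
  rw [PMF.toMeasure_apply_singleton _ _ (measurableSet_singleton _)]

theorem mem_support_of_serviceLaw_ne_zero {svc : Fin N → PMF ℕ} {s : Fin N → ℕ}
    (hs : serviceLaw svc s ≠ 0) (i : Fin N) : s i ∈ (svc i).support := by
  rw [serviceLaw_apply] at hs
  exact (PMF.mem_support_iff _ _).2 (Finset.prod_ne_zero_iff.1 hs i (Finset.mem_univ i))

theorem tsum_serviceLaw_mul_apply (svc : Fin N → PMF ℕ) (i : Fin N) :
    ∑' s, serviceLaw svc s * (s i : ℝ≥0∞) = ∑' k, svc i k * k := by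
  have h1 := MeasureTheory.lintegral_countable'
    (μ := MeasureTheory.Measure.pi fun n => (svc n).toMeasure) fun s => (s i : ℝ≥0∞)
  have h2 := MeasureTheory.lintegral_countable' (μ := (svc i).toMeasure) fun k => (k : ℝ≥0∞)
  have h3 := (MeasureTheory.measurePreserving_eval
    (fun n => (svc n).toMeasure) i).lintegral_comp (f := fun k : ℕ => (k : ℝ≥0∞))
    (Measurable.of_discrete)
  simp only [Function.eval] at h3
  rw [h1, h2] at h3
  simp only [PMF.toMeasure_apply_singleton _ _ (measurableSet_singleton _)] at h3
  rw [tsum_congr fun k : ℕ => mul_comm (svc i k) (k : ℝ≥0∞), ← h3]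
  refine tsum_congr fun s => ?_
  rw [serviceLaw, MeasureTheory.Measure.toPMF_apply, mul_comm]

theorem tsum_mul_add_const_le {β : Type*} (p : PMF β) {F G : β → ℝ≥0∞} {c : ℝ≥0∞}
    (h : ∀ x, p x ≠ 0 → F x + c ≤ G x) : ∑' x, p x * F x + c ≤ ∑' x, p x * G x := by
  calc ∑' x, p x * F x + c = ∑' x, p x * (F x + c) := by
        simp_rw [mul_add]
        rw [ENNReal.tsum_add, ENNReal.tsum_mul_right, PMF.tsum_coe, one_mul]
    _ ≤ ∑' x, p x * G x := by
        refine ENNReal.tsum_le_tsum fun x => ?_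
        by_cases hx : p x = 0
        · simp [hx]
        · exact mul_le_mul_right (h x hx) _

theorem tsum_mul_const_add {β : Type*} (p : PMF β) (c : ℝ≥0∞) (G : β → ℝ≥0∞) :
    ∑' x, p x * (c + G x) = c + ∑' x, p x * G x := by
  simp_rw [mul_add]
  rw [ENNReal.tsum_add, ENNReal.tsum_mul_right, PMF.tsum_coe, one_mul]

/-- A pointwise bound on one step which is affine in the arrivals and the services, averaged over
the step. All terms are moved to the side where they are nonnegative, so that no integrability
is needed. -/
theorem tsum_jbtChain_mul_add_le [NeZero N] {svc : Fin N → PMF ℕ} {Smax Amax : ℕ}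
    (hS : ∀ n, ∀ k ∈ (svc n).support, k ≤ Smax) (hμ : ∀ n, 0 < mean (svc n))
    {arr : PMF ℕ} (hA : ∀ k ∈ arr.support, k ≤ Amax) (r : ℝ) (z : State N)
    {g : State N → ℝ≥0∞} {α : ℝ≥0∞} {b d : Fin N → ℝ≥0∞}
    (h : ∀ a ≤ Amax, ∀ n, ∀ s : Fin N → ℕ, (∀ i, s i ≤ Smax) →
      g (nextState r z a n s) + ∑ i, b i * s i ≤ α + a * d n) :
    ∑' y, jbtChain r arr svc hμ z y * g y + ∑ i, b i * ENNReal.ofReal (mean (svc i)) ≤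
      α + ENNReal.ofReal (mean arr) * ∑' n, route svc hμ z.2 n * d n := by
  have hserv : ∑' s, serviceLaw svc s * ∑ i, b i * (s i : ℝ≥0∞)
      = ∑ i, b i * ENNReal.ofReal (mean (svc i)) := by
    simp_rw [Finset.mul_sum]
    rw [Summable.tsum_finsetSum fun _ _ => ENNReal.summable]
    refine Finset.sum_congr rfl fun i _ => ?_
    rw [ofReal_mean (hS i), ← tsum_serviceLaw_mul_apply, ← ENNReal.tsum_mul_left]
    exact tsum_congr fun s => by ring
  have hslot : ∀ a, arr a ≠ 0 → ∀ n,
      ∑' s, serviceLaw svc s * g (nextState r z a n s)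
        + ∑ i, b i * ENNReal.ofReal (mean (svc i)) ≤ α + a * d n := by
    intro a ha n
    rw [← hserv, ← ENNReal.tsum_add]
    simp_rw [← mul_add]
    have := tsum_mul_add_const_le (serviceLaw svc) (c := 0)
      (F := fun s => g (nextState r z a n s) + ∑ i, b i * (s i : ℝ≥0∞))
      (G := fun _ => α + a * d n) fun s hs => by
        rw [add_zero]
        exact h a (hA a ((PMF.mem_support_iff _ _).2 ha)) n s fun i =>
          hS i _ (mem_support_of_serviceLaw_ne_zero hs i)
    rwa [ENNReal.tsum_mul_right, PMF.tsum_coe, one_mul, add_zero] at this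
  simp_rw [jbtChain, tsum_bind_mul, tsum_pure_mul]
  refine (tsum_mul_add_const_le arr (fun a ha =>
    tsum_mul_add_const_le (route svc hμ z.2) fun n _ => hslot a ha n)).trans_eq ?_
  simp_rw [tsum_mul_const_add]
  rw [ofReal_mean hA, ← ENNReal.tsum_mul_right]
  congr 1
  refine tsum_congr fun a => ?_
  rw [← ENNReal.tsum_mul_left, ← ENNReal.tsum_mul_left]
  exact tsum_congr fun n => by ring

theorem candidates_nonempty [NeZero N] (m : Finset (Fin N)) : (candidates m).Nonempty := by
  unfold candidates
  split_ifs with h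
  · exact h
  · exact Finset.univ_nonempty

theorem tsum_route_mul [NeZero N] {svc : Fin N → PMF ℕ} (hμ : ∀ n, 0 < mean (svc n))
    (m : Finset (Fin N)) {x : Fin N → ℝ} (hx : ∀ n, 0 ≤ x n) :
    ∑' n, route svc hμ m n * ENNReal.ofReal (x n) = ENNReal.ofReal
      ((∑ n ∈ candidates m, mean (svc n) * x n) / ∑ n ∈ candidates m, mean (svc n)) := by
  have hpos : 0 < ∑ n ∈ candidates m, mean (svc n) :=
    Finset.sum_pos (fun n _ => hμ n) (candidates_nonempty m)
  have hden : ∑' n, routeWeight svc m n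
      = ENNReal.ofReal (∑ n ∈ candidates m, mean (svc n)) := by
    rw [tsum_fintype, ENNReal.ofReal_sum_of_nonneg fun n _ => (hμ n).le]
    simp [routeWeight, Finset.sum_ite_mem]
  rw [ENNReal.ofReal_div_of_pos hpos, ENNReal.ofReal_sum_of_nonneg
    fun n _ => mul_nonneg (hμ n).le (hx n), tsum_fintype, div_eq_mul_inv, ← hden, Finset.sum_mul,
    ← Finset.sum_subset (Finset.subset_univ (candidates m))]
  · refine Finset.sum_congr rfl fun n hn => ?_
    rw [route, PMF.normalize_apply, routeWeight, if_pos hn, ENNReal.ofReal_mul (hμ n).le]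
    ring
  · intro n _ hn
    rw [route, PMF.normalize_apply, routeWeight, if_neg hn, zero_mul, zero_mul]

/-! ### The structure of the chain -/

theorem jbtChain_apply_ne_zero_iff [NeZero N] {svc : Fin N → PMF ℕ}
    (hμ : ∀ n, 0 < mean (svc n)) (r : ℝ) (arr : PMF ℕ) (z y : State N) :
    jbtChain r arr svc hμ z y ≠ 0 ↔ ∃ a n s, arr a ≠ 0 ∧ route svc hμ z.2 n ≠ 0 ∧
      serviceLaw svc s ≠ 0 ∧ y = nextState r z a n s := by
  simp only [jbtChain, ← PMF.mem_support_iff, PMF.mem_support_bind_iff, PMF.mem_support_pure_iff]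
  constructor
  · rintro ⟨a, ha, n, hn, s, hs, h⟩
    exact ⟨a, n, s, ha, hn, hs, h⟩
  · rintro ⟨a, n, s, ha, hn, hs, h⟩
    exact ⟨a, ha, n, hn, s, hs, h⟩

/-- From every state, reachable or not, the chain can reach the empty state: with positive
probability nothing arrives and every server offers service for as long as it takes to empty the
queues; one more such slot then makes all servers report, since `r > 0`. -/
theorem reaches_emptyState [NeZero N] {svc : Fin N → PMF ℕ} (hμ : ∀ n, 0 < mean (svc n))
    {r : ℝ} (hr : 0 < r) {arr : PMF ℕ} (h0 : 0 ∈ arr.support) (z : State N) :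
    Reaches (jbtChain r arr svc hμ) z (emptyState N) := by
  have hex : ∀ n, ∃ k : ℕ, k ≠ 0 ∧ svc n k ≠ 0 := by
    intro n
    by_contra! h
    refine (hμ n).ne' ((tsum_congr fun k => ?_).trans tsum_zero)
    by_cases hk : k = 0
    · simp [hk]
    · simp [h k hk]
  choose s hs using hex
  have hsl : serviceLaw svc s ≠ 0 := by
    rw [serviceLaw_apply]
    exact Finset.prod_ne_zero_iff.2 fun n _ => (hs n).2
  have hstep : ∀ z : State N, ∃ n, jbtChain r arr svc hμ z (nextState r z 0 n s) ≠ 0 := by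
    intro z
    obtain ⟨n, hn⟩ := (route svc hμ z.2).support_nonempty
    exact ⟨n, (jbtChain_apply_ne_zero_iff hμ r arr z _).2
      ⟨0, n, s, (PMF.mem_support_iff _ _).1 h0, (PMF.mem_support_iff _ _).1 hn, hsl, rfl⟩⟩
  have key : ∀ k : ℕ, ∀ z : State N, (∀ i, z.1 i ≤ k) →
      Reaches (jbtChain r arr svc hμ) z (emptyState N) := by
    intro k
    induction k with
    | zero =>
      intro z hz
      obtain ⟨n, hn⟩ := hstep z
      have hQ : nextQueue z.1 0 n s = fun _ => 0 := by
        funext i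
        have := hz i
        simp only [nextQueue, ite_self]
        omega
      have : nextState r z 0 n s = emptyState N := by
        simp [nextState, hQ, nextMemory, emptyState, hr]
      exact Relation.ReflTransGen.single (this ▸ hn)
    | succ k ih =>
      intro z hz
      obtain ⟨n, hn⟩ := hstep z
      refine Relation.ReflTransGen.head hn (ih _ fun i => ?_)
      have h1 := hz i
      have h2 := (hs i).1
      simp only [nextState, nextQueue, ite_self]
      omega
  exact key (Finset.univ.sup z.1) z fun i => Finset.le_sup (Finset.mem_univ i)

/-- In a reachable state, the IDs in memory are exactly those of the servers below the threshold:
since its last report, a server in memory has received no arrivals. -/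
theorem mem_memory_iff_of_reaches [NeZero N] {svc : Fin N → PMF ℕ} {hμ : ∀ n, 0 < mean (svc n)}
    {r : ℝ} (hr : 0 < r) {arr : PMF ℕ} {z : State N}
    (hz : Reaches (jbtChain r arr svc hμ) (emptyState N) z) (i : Fin N) :
    i ∈ z.2 ↔ (z.1 i : ℝ) < r := by
  induction hz with
  | refl => simp [emptyState, hr]
  | @tail y z' _ hyz ih =>
    obtain ⟨a, n, s, -, -, -, rfl⟩ := (jbtChain_apply_ne_zero_iff hμ r arr _ _).1 hyz
    simp only [nextState, nextMemory, Finset.mem_union, Finset.mem_filter, Finset.mem_univ,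
      true_and, or_iff_right_iff_imp]
    intro hi
    have hle : nextQueue y.1 a n s i ≤ y.1 i ∧ i ∈ y.2 := by
      split_ifs at hi with ha
      · exact ⟨by simp [nextQueue, ha], hi⟩
      · rw [Finset.mem_erase] at hi
        exact ⟨by simp [nextQueue, hi.1], hi.2⟩
    exact lt_of_le_of_lt (by exact_mod_cast hle.1) (ih.1 hle.2)

/-- The comparison with random routing, which holds for every threshold: the candidates have the
shortest queues, so the average of the queue lengths over the candidates, weighted by the service
rates, is at most the weighted average over all servers. -/
theorem candidates_average_le [NeZero N] {w Q : Fin N → ℝ} (hw : ∀ n, 0 < w n) {r : ℝ}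
    {m : Finset (Fin N)} (hm : ∀ i, i ∈ m ↔ Q i < r) :
    (∑ n ∈ candidates m, w n * Q n) / ∑ n ∈ candidates m, w n ≤
      (∑ n, w n * Q n) / ∑ n, w n := by
  by_cases hne : m.Nonempty
  · rw [candidates, if_pos hne, div_le_div_iff₀ (Finset.sum_pos (fun n _ => hw n) hne)
      (Finset.sum_pos (fun n _ => hw n) Finset.univ_nonempty),
      ← Finset.sum_add_sum_compl m fun n => w n, ← Finset.sum_add_sum_compl m fun n => w n * Q n]
    have h1 : ∑ n ∈ m, w n * Q n ≤ r * ∑ n ∈ m, w n := by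
      rw [Finset.mul_sum]
      refine Finset.sum_le_sum fun n hn => ?_
      nlinarith [hw n, (hm n).1 hn]
    have h2 : r * ∑ n ∈ mᶜ, w n ≤ ∑ n ∈ mᶜ, w n * Q n := by
      rw [Finset.mul_sum]
      refine Finset.sum_le_sum fun n hn => ?_
      have : r ≤ Q n := not_lt.1 fun h => Finset.mem_compl.1 hn ((hm n).2 h)
      nlinarith [hw n]
    have h3 : 0 ≤ ∑ n ∈ m, w n := Finset.sum_nonneg fun n _ => (hw n).le
    have h4 : 0 ≤ ∑ n ∈ mᶜ, w n := Finset.sum_nonneg fun n _ => (hw n).le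
    nlinarith [mul_le_mul_of_nonneg_right h1 h4, mul_le_mul_of_nonneg_right h2 h3]
  · rw [candidates, if_neg hne]

/-! ### The smoothed norm and its drift -/

/-- The smoothed norm `√(‖Q‖² + B²)` of the queue length vector. -/
def smoothNorm (B : ℝ) (z : State N) : ℝ :=
  √(queueNorm z ^ 2 + B ^ 2)

theorem queueNorm_nonneg (z : State N) : 0 ≤ queueNorm z :=
  norm_nonneg _

theorem queueNorm_sq (z : State N) : queueNorm z ^ 2 = ∑ i, (z.1 i : ℝ) ^ 2 := by
  rw [queueNorm, EuclideanSpace.norm_eq, Real.sq_sqrt (by positivity)]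
  simp

theorem le_queueNorm (z : State N) (i : Fin N) : (z.1 i : ℝ) ≤ queueNorm z := by
  refine le_of_sq_le_sq ?_ (queueNorm_nonneg z)
  rw [queueNorm_sq]
  exact Finset.single_le_sum (f := fun i => (z.1 i : ℝ) ^ 2) (fun _ _ => by positivity)
    (Finset.mem_univ i)

theorem queueNorm_le_sum (z : State N) : queueNorm z ≤ ∑ i, (z.1 i : ℝ) := by
  refine le_of_sq_le_sq ?_ (Finset.sum_nonneg fun _ _ => by positivity)
  rw [queueNorm_sq]
  exact Finset.sum_sq_le_sq_sum_of_nonneg fun _ _ => by positivity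

theorem smoothNorm_sq (B : ℝ) (z : State N) :
    smoothNorm B z ^ 2 = ∑ i, (z.1 i : ℝ) ^ 2 + B ^ 2 := by
  rw [smoothNorm, Real.sq_sqrt (by positivity), queueNorm_sq]

theorem queueNorm_le_smoothNorm (B : ℝ) (z : State N) : queueNorm z ≤ smoothNorm B z :=
  Real.le_sqrt_of_sq_le (by nlinarith [sq_nonneg B])

theorem le_smoothNorm (B : ℝ) (z : State N) : B ≤ smoothNorm B z :=
  Real.le_sqrt_of_sq_le (by nlinarith [sq_nonneg (queueNorm z)])

theorem smoothNorm_le {B : ℝ} (hB : 0 ≤ B) (z : State N) : smoothNorm B z ≤ queueNorm z + B := by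
  have := queueNorm_nonneg z
  exact Real.sqrt_le_iff.2 ⟨by positivity, by nlinarith [mul_nonneg this hB]⟩

theorem sq_smoothNorm_sub_le (B : ℝ) (z z' : State N) :
    (smoothNorm B z' - smoothNorm B z) ^ 2 ≤ ∑ i, ((z'.1 i : ℝ) - z.1 i) ^ 2 := by
  have hcs := Finset.sum_mul_sq_le_sq_mul_sq Finset.univ
    (fun i => (z'.1 i : ℝ)) (fun i => (z.1 i : ℝ))
  have hprod : ∑ i, (z'.1 i : ℝ) * z.1 i + B ^ 2 ≤ smoothNorm B z' * smoothNorm B z := by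
    have h1 := smoothNorm_sq B z
    have h2 := smoothNorm_sq B z'
    refine le_of_sq_le_sq ?_ (mul_nonneg (Real.sqrt_nonneg _) (Real.sqrt_nonneg _))
    rw [mul_pow, h1, h2]
    have hsum : 2 * ∑ i, (z'.1 i : ℝ) * z.1 i ≤ ∑ i, (z'.1 i : ℝ) ^ 2 + ∑ i, (z.1 i : ℝ) ^ 2 := by
      rw [Finset.mul_sum, ← Finset.sum_add_distrib]
      exact Finset.sum_le_sum fun i _ => by nlinarith [sq_nonneg ((z'.1 i : ℝ) - z.1 i)]
    nlinarith [mul_le_mul_of_nonneg_right hsum (sq_nonneg B)]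
  have hexp : ∑ i, ((z'.1 i : ℝ) - z.1 i) ^ 2
      = ∑ i, (z'.1 i : ℝ) ^ 2 + ∑ i, (z.1 i : ℝ) ^ 2 - 2 * ∑ i, (z'.1 i : ℝ) * z.1 i := by
    rw [Finset.mul_sum, ← Finset.sum_add_distrib, ← Finset.sum_sub_distrib]
    exact Finset.sum_congr rfl fun i _ => by ring
  rw [hexp]
  nlinarith [smoothNorm_sq B z, smoothNorm_sq B z']

/-- A bound on the square of the net input `A - S` of a time slot. -/
def stepBound (N Smax Amax : ℕ) : ℝ :=
  (Amax : ℝ) ^ 2 + N * (Smax : ℝ) ^ 2 + 1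

theorem one_le_stepBound (N Smax Amax : ℕ) : 1 ≤ stepBound N Smax Amax := by
  unfold stepBound
  have : (0 : ℝ) ≤ (Amax : ℝ) ^ 2 + N * (Smax : ℝ) ^ 2 := by positivity
  linarith

section Step

variable {Smax Amax a : ℕ} {n : Fin N} {s : Fin N → ℕ}

theorem sum_sq_netInput_le (ha : a ≤ Amax) (hs : ∀ i, s i ≤ Smax) :
    ∑ i, ((if i = n then (a : ℝ) else 0) - s i) ^ 2 ≤ stepBound N Smax Amax := by
  have ha' : (a : ℝ) ≤ Amax := by exact_mod_cast ha
  calc ∑ i, ((if i = n then (a : ℝ) else 0) - s i) ^ 2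
      ≤ ∑ i, ((if i = n then (a : ℝ) ^ 2 else 0) + (Smax : ℝ) ^ 2) := by
        refine Finset.sum_le_sum fun i _ => ?_
        have hsi : (s i : ℝ) ≤ Smax := by exact_mod_cast hs i
        have h0 : (0 : ℝ) ≤ s i := by positivity
        have h1 : (0 : ℝ) ≤ a := by positivity
        split_ifs <;> nlinarith [mul_nonneg h1 h0]
    _ = (a : ℝ) ^ 2 + N * (Smax : ℝ) ^ 2 := by
        rw [Finset.sum_add_distrib]
        simp
    _ ≤ stepBound N Smax Amax := by
        unfold stepBound
        nlinarith [(Nat.cast_nonneg a : (0 : ℝ) ≤ a)]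

theorem nextQueue_cast (Q : Fin N → ℕ) (i : Fin N) :
    (nextQueue Q a n s i : ℝ) = max (Q i + ((if i = n then (a : ℝ) else 0) - s i)) 0 := by
  rw [nextQueue, ← add_sub_assoc]
  rcases le_total (s i) (Q i + if i = n then a else 0) with h | h
  · have h' : (s i : ℝ) ≤ Q i + if i = n then (a : ℝ) else 0 := by exact_mod_cast h
    rw [Nat.cast_sub h, max_eq_left (by linarith)]
    push_cast
    rfl
  · have h' : (Q i + if i = n then (a : ℝ) else 0) ≤ (s i : ℝ) := by exact_mod_cast h
    rw [Nat.sub_eq_zero_of_le h, max_eq_right (by linarith), Nat.cast_zero]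

theorem sq_smoothNorm_step_le (B r : ℝ) (z : State N) (ha : a ≤ Amax) (hs : ∀ i, s i ≤ Smax) :
    (smoothNorm B (nextState r z a n s) - smoothNorm B z) ^ 2 ≤ stepBound N Smax Amax := by
  refine (sq_smoothNorm_sub_le B _ _).trans
    (le_trans (Finset.sum_le_sum fun i _ => ?_) (sum_sq_netInput_le (n := n) ha hs))
  simp only [nextState]
  rw [nextQueue_cast]
  have : (0 : ℝ) ≤ z.1 i := by positivity
  generalize (if i = n then (a : ℝ) else 0) - s i = x
  rcases max_cases ((z.1 i : ℝ) + x) 0 with h | h <;> rw [h.1] <;> nlinarith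

theorem smoothNorm_sq_step_le (B r : ℝ) (z : State N) (ha : a ≤ Amax) (hs : ∀ i, s i ≤ Smax) :
    smoothNorm B (nextState r z a n s) ^ 2 - smoothNorm B z ^ 2 ≤
      2 * (a * z.1 n - ∑ i, (z.1 i : ℝ) * s i) + stepBound N Smax Amax := by
  have hlin : ∑ i, (z.1 i : ℝ) * ((if i = n then (a : ℝ) else 0) - s i)
      = a * z.1 n - ∑ i, (z.1 i : ℝ) * s i := by
    simp_rw [mul_sub]
    rw [Finset.sum_sub_distrib]
    simp [mul_comm]
  have hsq : ∑ i, ((nextState r z a n s).1 i : ℝ) ^ 2 ≤ ∑ i, ((z.1 i : ℝ) ^ 2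
      + 2 * ((z.1 i : ℝ) * ((if i = n then (a : ℝ) else 0) - s i))
      + ((if i = n then (a : ℝ) else 0) - s i) ^ 2) := by
    refine Finset.sum_le_sum fun i _ => ?_
    simp only [nextState]
    rw [nextQueue_cast]
    generalize (if i = n then (a : ℝ) else 0) - s i = x
    rcases max_cases ((z.1 i : ℝ) + x) 0 with h | h <;> rw [h.1] <;>
      nlinarith [sq_nonneg ((z.1 i : ℝ) + x)]
  rw [Finset.sum_add_distrib, Finset.sum_add_distrib, ← Finset.mul_sum, hlin] at hsq
  rw [smoothNorm_sq, smoothNorm_sq]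
  linarith [sum_sq_netInput_le (n := n) ha hs]

/-- The exponential of the smoothed norm after one step. The increment of `√(‖Q‖² + B²)` is
bounded, so `e^x ≤ 1 + x + x²` applies; since the square root is concave, it is at most the
increment of `‖Q‖²` divided by `2 √(‖Q‖² + B²)`. -/
theorem exp_smoothNorm_step_le {B r θ : ℝ} (hB : 0 < B) (hθ : 0 < θ)
    (hθK : θ * stepBound N Smax Amax ≤ 1) (z : State N) (ha : a ≤ Amax) (hs : ∀ i, s i ≤ Smax) :
    Real.exp (θ * smoothNorm B (nextState r z a n s)) ≤
      Real.exp (θ * smoothNorm B z) * (1 + θ * (θ * stepBound N Smax Amax)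
        + θ / smoothNorm B z * (stepBound N Smax Amax / 2)
        + θ / smoothNorm B z * (a * z.1 n - ∑ i, (z.1 i : ℝ) * s i)) := by
  have hK := one_le_stepBound N Smax Amax
  have hf : 0 < smoothNorm B z := hB.trans_le (le_smoothNorm B z)
  have hjump := sq_smoothNorm_step_le (n := n) B r z ha hs
  have hdrift := smoothNorm_sq_step_le (n := n) B r z ha hs
  set K := stepBound N Smax Amax
  set f := smoothNorm B z
  set f' := smoothNorm B (nextState r z a n s)
  set l := (a : ℝ) * z.1 n - ∑ i, (z.1 i : ℝ) * s i
  have hx2 : (θ * (f' - f)) ^ 2 ≤ θ * (θ * K) := by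
    rw [mul_pow]
    nlinarith [mul_le_mul_of_nonneg_left hjump (sq_nonneg θ)]
  have hx1 : |θ * (f' - f)| ≤ 1 := by
    rw [abs_le_one_iff_mul_self_le_one]
    nlinarith [mul_nonneg hθ.le (sub_nonneg.2 hK)]
  have hexp : Real.exp (θ * (f' - f)) ≤ 1 + θ * (f' - f) + θ * (θ * K) := by
    have := (abs_le.1 (Real.abs_exp_sub_one_sub_id_le hx1)).2
    linarith
  have hlin : f' - f ≤ (K / 2 + l) / f := by
    rw [le_div_iff₀ hf]
    nlinarith [sq_nonneg (f' - f)]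
  have hsplit : Real.exp (θ * f') = Real.exp (θ * f) * Real.exp (θ * (f' - f)) := by
    rw [← Real.exp_add]
    ring_nf
  rw [hsplit]
  refine mul_le_mul_of_nonneg_left (hexp.trans ?_) (Real.exp_pos _).le
  have := mul_le_mul_of_nonneg_left hlin hθ.le
  have heq : θ * ((K / 2 + l) / f) = θ / f * (K / 2) + θ / f * l := by ring
  linarith

end Step

/-- The mean of the exponential of the smoothed norm after one step. Here `κ` is a lower bound on
the rate at which the queue lengths drift towards `0` under random routing, and `hz` says that the
memory is consistent with the threshold, as it is in all reachable states. -/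
theorem tsum_jbtChain_exp_le [NeZero N] {svc : Fin N → PMF ℕ} {Smax Amax : ℕ}
    (hS : ∀ n, ∀ k ∈ (svc n).support, k ≤ Smax) (hμ : ∀ n, 0 < mean (svc n))
    {ε : ℝ} {arr : PMF ℕ} (harr : IsArrivalLaw svc Amax ε arr) {r : ℝ} {z : State N}
    (hz : ∀ i, i ∈ z.2 ↔ (z.1 i : ℝ) < r) {κ B θ : ℝ}
    (hκ : κ * queueNorm z ≤ ε / (∑ n, mean (svc n)) * ∑ n, mean (svc n) * z.1 n)
    (hB : 0 < B) (hθ : 0 < θ) (hθK : θ * stepBound N Smax Amax ≤ 1) :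
    ∑' y, jbtChain r arr svc hμ z y * ENNReal.ofReal (Real.exp (θ * smoothNorm B y)) ≤
      ENNReal.ofReal (Real.exp (θ * smoothNorm B z) * (1 + θ * (θ * stepBound N Smax Amax)
        + θ / smoothNorm B z * (stepBound N Smax Amax / 2 - κ * queueNorm z))) := by
  have hK := one_le_stepBound N Smax Amax
  have hf : 0 < smoothNorm B z := hB.trans_le (le_smoothNorm B z)
  have hM : 0 < ∑ n, mean (svc n) := Finset.sum_pos (fun n _ => hμ n) Finset.univ_nonempty
  have hcand := candidates_average_le (Q := fun n => (z.1 n : ℝ)) hμ hz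
  have hl : 0 ≤ mean arr := mean_nonneg arr
  have hmean := harr.mean_eq
  have hcpos : 0 ≤ (∑ n ∈ candidates z.2, mean (svc n) * (z.1 n : ℝ))
      / ∑ n ∈ candidates z.2, mean (svc n) :=
    div_nonneg (Finset.sum_nonneg fun n _ => mul_nonneg (hμ n).le (by positivity))
      (Finset.sum_nonneg fun n _ => (hμ n).le)
  set K := stepBound N Smax Amax
  set W := Real.exp (θ * smoothNorm B z) with hW
  have hWpos : 0 < W := Real.exp_pos _
  set β := W * (θ / smoothNorm B z) with hβ
  have hβ0 : 0 < β := by positivity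
  set α := W * (1 + θ * (θ * K) + θ / smoothNorm B z * (K / 2)) with hα
  have hα0 : 0 ≤ α := by positivity
  have hstep := tsum_jbtChain_mul_add_le hS hμ harr.le_max r z
    (g := fun y => ENNReal.ofReal (Real.exp (θ * smoothNorm B y)))
    (α := ENNReal.ofReal α) (b := fun i => ENNReal.ofReal (β * z.1 i))
    (d := fun n => ENNReal.ofReal (β * z.1 n)) (by
      intro a ha n s hs
      have h := exp_smoothNorm_step_le (r := r) (n := n) hB hθ hθK z ha hs
      simp_rw [← ENNReal.ofReal_natCast]
      simp_rw [← ENNReal.ofReal_mul (mul_nonneg hβ0.le (Nat.cast_nonneg _))]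
      rw [← ENNReal.ofReal_sum_of_nonneg (fun i _ => by positivity),
        ← ENNReal.ofReal_add (by positivity) (Finset.sum_nonneg fun i _ => by positivity),
        ← ENNReal.ofReal_mul (by positivity), ← ENNReal.ofReal_add hα0 (by positivity)]
      refine ENNReal.ofReal_le_ofReal ?_
      simp_rw [mul_assoc β]
      rw [← Finset.mul_sum]
      simp only [hα, hβ, hW] at h ⊢
      linarith)
  rw [tsum_route_mul hμ _ fun n => by positivity, ← ENNReal.ofReal_mul hl,
    ← ENNReal.ofReal_add hα0] at hstep
  · simp_rw [← ENNReal.ofReal_mul (mul_nonneg hβ0.le (Nat.cast_nonneg _))] at hstep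
    have hterm : ∀ i, 0 ≤ β * (z.1 i : ℝ) * mean (svc i) := fun i =>
      mul_nonneg (by positivity) (hμ i).le
    rw [← ENNReal.ofReal_sum_of_nonneg fun i _ => hterm i] at hstep
    refine (ENNReal.le_sub_of_add_le_right ENNReal.ofReal_ne_top hstep).trans ?_
    rw [← ENNReal.ofReal_sub _ (Finset.sum_nonneg fun i _ => hterm i)]
    refine ENNReal.ofReal_le_ofReal ?_
    have h1 : ∑ n ∈ candidates z.2, mean (svc n) * (β * (z.1 n : ℝ))
        = β * ∑ n ∈ candidates z.2, mean (svc n) * (z.1 n : ℝ) := by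
      rw [Finset.mul_sum]
      exact Finset.sum_congr rfl fun n _ => by ring
    have h2 : ∑ n, β * (z.1 n : ℝ) * mean (svc n) = β * ∑ n, mean (svc n) * (z.1 n : ℝ) := by
      rw [Finset.mul_sum]
      exact Finset.sum_congr rfl fun n _ => by ring
    rw [h1, h2, mul_div_assoc]
    set T := ∑ n, mean (svc n) * (z.1 n : ℝ)
    set M := ∑ n, mean (svc n)
    have h3 : mean arr * (T / M) - T = - (ε / M * T) := by
      rw [hmean]
      field_simp
      ring
    have h4 : mean arr * (β * ((∑ n ∈ candidates z.2, mean (svc n) * (z.1 n : ℝ))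
        / ∑ n ∈ candidates z.2, mean (svc n))) - β * T ≤ β * (-(κ * queueNorm z)) := by
      have := mul_le_mul_of_nonneg_left hcand hl
      nlinarith
    have h5 : W * (1 + θ * (θ * K) + θ / smoothNorm B z * (K / 2 - κ * queueNorm z))
        = α + β * (-(κ * queueNorm z)) := by
      rw [hα, hβ]
      ring
    linarith
  · have h1 : ∀ n, 0 ≤ mean (svc n) * (β * (z.1 n : ℝ)) := fun n =>
      mul_nonneg (hμ n).le (by positivity)
    exact mul_nonneg hl (div_nonneg (Finset.sum_nonneg fun n _ => h1 n)
      (Finset.sum_nonneg fun n _ => (hμ n).le))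

/-- The elementary inequality behind the geometric drift. With `B = K / (2 κ)`, the relative
increment of `e^{θ f}` is at most `θ (K / f - κ / 2)`. This is at most `- θ κ / 4` if
`f ≥ 4 K / κ`, and otherwise of the same order `θ κ`, because `f ≥ B`; so the constant term has
the same factor `θ κ / 4` as the contraction, and the ratio of the two is free of `κ`. -/
theorem exp_mul_le_of_drift {K κ θ f u : ℝ} (hK : 0 < K) (hκ : 0 < κ) (hθ : 0 < θ)
    (hθK : θ * K ≤ κ / 2) (hBf : K / (2 * κ) ≤ f) (hfu : f ≤ u + K / (2 * κ)) :
    Real.exp (θ * f) * (1 + θ * (θ * K) + θ / f * (K / 2 - κ * u)) ≤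
      (1 - θ * κ / 4) * Real.exp (θ * f)
        + θ * κ / 4 * (7 * Real.exp (θ * (4 * K / κ))) := by
  have hB : 0 < K / (2 * κ) := by positivity
  have hf : 0 < f := hB.trans_le hBf
  have hW := Real.exp_pos (θ * f)
  have hδ : 0 < θ * κ := by positivity
  have hcoef : 1 + θ * (θ * K) + θ / f * (K / 2 - κ * u) ≤ 1 + θ * (K / f) - θ * κ / 2 := by
    have h1 : K / 2 - κ * u ≤ K - κ * f := by
      have : κ * (K / (2 * κ)) = K / 2 := by field_simp
      nlinarith [mul_le_mul_of_nonneg_left hfu hκ.le]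
    have h2 := mul_le_mul_of_nonneg_left h1 (div_pos hθ hf).le
    have h3 : θ / f * (K - κ * f) = θ * (K / f) - θ * κ := by field_simp
    nlinarith [mul_le_mul_of_nonneg_left hθK hθ.le]
  rcases le_or_gt (4 * K / κ) f with h | h
  · have hKf : K / f ≤ κ / 4 := by
      rw [div_le_iff₀ hf]
      rw [div_le_iff₀ hκ] at h
      linarith
    have : 1 + θ * (θ * K) + θ / f * (K / 2 - κ * u) ≤ 1 - θ * κ / 4 := by
      nlinarith [mul_le_mul_of_nonneg_left hKf hθ.le]
    have h0 : 0 ≤ θ * κ / 4 * (7 * Real.exp (θ * (4 * K / κ))) := by positivity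
    nlinarith [mul_le_mul_of_nonneg_left this hW.le]
  · have hKf : K / f ≤ 2 * κ := by
      rw [div_le_iff₀ hf]
      rw [div_le_iff₀ (by positivity)] at hBf
      linarith
    have : 1 + θ * (θ * K) + θ / f * (K / 2 - κ * u) ≤ 1 + 6 * (θ * κ / 4) := by
      nlinarith [mul_le_mul_of_nonneg_left hKf hθ.le]
    have hexp : Real.exp (θ * f) ≤ Real.exp (θ * (4 * K / κ)) :=
      Real.exp_le_exp.2 (mul_le_mul_of_nonneg_left h.le hθ.le)
    nlinarith [mul_le_mul_of_nonneg_left this hW.le, mul_le_mul_of_nonneg_left hexp hδ.le]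

/-! ### The steady state -/

theorem finite_setOf_exp_smoothNorm_le {θ B : ℝ} (hθ : 0 < θ) (M : ℕ) :
    {z : State N | ENNReal.ofReal (Real.exp (θ * smoothNorm B z)) ≤ M}.Finite := by
  obtain ⟨R, hR⟩ := exists_nat_ge ((M : ℝ) / θ)
  refine ((Set.finite_Icc (fun _ : Fin N => 0) fun _ => R).prod
    (Set.finite_univ (α := Finset (Fin N)))).subset fun z hz => ⟨⟨fun _ => Nat.zero_le _, ?_⟩,
      Set.mem_univ _⟩
  intro i
  have hz' : Real.exp (θ * smoothNorm B z) ≤ M := by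
    have : ENNReal.ofReal (Real.exp (θ * smoothNorm B z)) ≤ M := hz
    rwa [← ENNReal.ofReal_natCast, ENNReal.ofReal_le_ofReal_iff (by positivity)] at this
  have h1 := Real.add_one_le_exp (θ * smoothNorm B z)
  have h2 : (z.1 i : ℝ) ≤ smoothNorm B z := (le_queueNorm z i).trans (queueNorm_le_smoothNorm B z)
  have h3 : (z.1 i : ℝ) ≤ M / θ := by
    rw [le_div_iff₀ hθ]
    nlinarith
  exact_mod_cast h3.trans hR

/-- The exponential moments are bounded along the chain started at the empty state. -/
theorem tsum_stepLaw_exp_le [NeZero N] {svc : Fin N → PMF ℕ} {Smax Amax : ℕ}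
    (hS : ∀ n, ∀ k ∈ (svc n).support, k ≤ Smax) (hμ : ∀ n, 0 < mean (svc n))
    {ε : ℝ} {arr : PMF ℕ} (harr : IsArrivalLaw svc Amax ε arr) {r : ℝ} (hr : 0 < r) {κ θ : ℝ}
    (hκ0 : 0 < κ) (hκ1 : κ ≤ 1) (hκ : ∀ z : State N,
      κ * queueNorm z ≤ ε / (∑ n, mean (svc n)) * ∑ n, mean (svc n) * z.1 n)
    (hθ : 0 < θ) (hθK : θ * stepBound N Smax Amax ≤ κ / 2) (k : ℕ) :
    ∑' z, stepLaw (jbtChain r arr svc hμ) (emptyState N) k z * ENNReal.ofReal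
        (Real.exp (θ * smoothNorm (stepBound N Smax Amax / (2 * κ)) z)) ≤
      ENNReal.ofReal (7 * Real.exp (θ * (4 * stepBound N Smax Amax / κ))) := by
  have hK := one_le_stepBound N Smax Amax
  set K := stepBound N Smax Amax
  have hB : 0 < K / (2 * κ) := by positivity
  have hδ : θ * κ / 4 ≤ 1 := by nlinarith
  have hδ0 : 0 < θ * κ / 4 := by positivity
  refine tsum_stepLaw_mul_le (γ := ENNReal.ofReal (1 - θ * κ / 4))
    (b := ENNReal.ofReal (θ * κ / 4 * (7 * Real.exp (θ * (4 * K / κ))))) ?_ ?_ ?_ k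
  · intro z hz
    refine (tsum_jbtChain_exp_le hS hμ harr (mem_memory_iff_of_reaches hr hz) (hκ z) hB hθ
      (by linarith)).trans ?_
    rw [← ENNReal.ofReal_mul (by linarith), ← ENNReal.ofReal_add
      (mul_nonneg (by linarith) (Real.exp_pos _).le) (by positivity)]
    exact ENNReal.ofReal_le_ofReal (exp_mul_le_of_drift (by linarith) hκ0 hθ hθK
      (le_smoothNorm _ z) (smoothNorm_le hB.le z))
  · rw [← ENNReal.ofReal_mul (by linarith), ← ENNReal.ofReal_add
      (mul_nonneg (by linarith) (by positivity)) (by positivity)]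
    exact ENNReal.ofReal_le_ofReal (by linarith)
  · refine ENNReal.ofReal_le_ofReal ?_
    have h0 : queueNorm (emptyState N) = 0 := by
      have := queueNorm_sq (emptyState N)
      simpa [emptyState] using this
    have h1 : smoothNorm (K / (2 * κ)) (emptyState N) ≤ 4 * K / κ := by
      refine (smoothNorm_le hB.le _).trans ?_
      rw [h0, zero_add, div_le_div_iff₀ (by positivity) hκ0]
      nlinarith [mul_pos (show 0 < K by linarith) hκ0]
    have h2 := Real.exp_le_exp.2 (mul_le_mul_of_nonneg_left h1 hθ.le)
    linarith [Real.exp_pos (θ * (4 * K / κ))]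

theorem expect_mono {α : Type*} (π : PMF α) {f g : α → ℝ} (h : ∀ z, f z ≤ g z) :
    expect π f ≤ expect π g :=
  ENNReal.tsum_le_tsum fun z => mul_le_mul_right (ENNReal.ofReal_le_ofReal (h z)) _

theorem expect_const_mul {α : Type*} (π : PMF α) {c : ℝ} (hc : 0 ≤ c) (f : α → ℝ) :
    expect π (fun z => c * f z) = ENNReal.ofReal c * expect π f := by
  rw [expect, expect, ← ENNReal.tsum_mul_left]
  refine tsum_congr fun z => ?_
  rw [ENNReal.ofReal_mul hc]
  ring

/-- The steady state exists, and it has exponential moments of order `ε`, with constants which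
depend only on the service laws and on the bounds on the arrivals and services. -/
theorem exists_isStationary_expect_exp_le [NeZero N] {svc : Fin N → PMF ℕ} {Smax : ℕ} (Amax : ℕ)
    (hS : ∀ n, ∀ k ∈ (svc n).support, k ≤ Smax) (hμ : ∀ n, 0 < mean (svc n)) :
    ∃ c K₂ : ℝ, 0 < c ∧ 0 < K₂ ∧ ∀ r : ℝ, 0 < r → ∀ ε : ℝ, 0 < ε → ∀ arr : PMF ℕ,
      IsArrivalLaw svc Amax ε arr → ∃ π : PMF (State N),
        IsStationary (jbtChain r arr svc hμ) π ∧ ∀ θ : ℝ, 0 < θ → θ ≤ c * ε →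
          expect π (fun z => Real.exp (θ * queueNorm z)) ≤
            ENNReal.ofReal (7 * Real.exp (θ * K₂ / ε)) := by
  have hM : 0 < ∑ n, mean (svc n) := Finset.sum_pos (fun n _ => hμ n) Finset.univ_nonempty
  have hK := one_le_stepBound N Smax Amax
  -- The cap `m ≤ 1` makes the drift rate `κ = ε * (m / M)` at most `1`, as `ε ≤ M`.
  obtain ⟨m, hm0, hm1, hm⟩ : ∃ m : ℝ, 0 < m ∧ m ≤ 1 ∧ ∀ n, m ≤ mean (svc n) := by
    obtain ⟨n₀, -, hn₀⟩ := Finset.exists_min_image Finset.univ (fun n => mean (svc n))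
      Finset.univ_nonempty
    exact ⟨min (mean (svc n₀)) 1, lt_min (hμ n₀) one_pos, min_le_right _ _,
      fun n => (min_le_left _ _).trans (hn₀ n (Finset.mem_univ n))⟩
  set K := stepBound N Smax Amax
  set M := ∑ n, mean (svc n)
  refine ⟨m / M / (2 * K), 4 * K / (m / M), by positivity, by positivity, ?_⟩
  intro r hr ε hε arr harr
  have hεM : ε ≤ M := by
    have := mean_nonneg arr
    rw [harr.mean_eq] at this
    linarith
  set κ := ε * (m / M) with hκ
  have hκ0 : 0 < κ := by positivity
  have hκ1 : κ ≤ 1 := by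
    rw [hκ, ← mul_div_assoc, div_le_one hM]
    nlinarith
  have hdrift : ∀ z : State N, κ * queueNorm z ≤ ε / M * ∑ n, mean (svc n) * (z.1 n : ℝ) := by
    intro z
    have h1 : m * queueNorm z ≤ ∑ n, mean (svc n) * (z.1 n : ℝ) := by
      refine (mul_le_mul_of_nonneg_left (queueNorm_le_sum z) hm0.le).trans ?_
      rw [Finset.mul_sum]
      exact Finset.sum_le_sum fun n _ => mul_le_mul_of_nonneg_right (hm n) (by positivity)
    calc κ * queueNorm z = ε / M * (m * queueNorm z) := by rw [hκ]; ring
      _ ≤ _ := mul_le_mul_of_nonneg_left h1 (by positivity)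
  have hθK : ∀ θ ≤ m / M / (2 * K) * ε, θ * K ≤ κ / 2 := by
    intro θ hθ
    refine (mul_le_mul_of_nonneg_right hθ (by linarith)).trans_eq ?_
    rw [hκ]
    field_simp
  have hbound := fun θ (hθ0 : 0 < θ) (hθ : θ ≤ m / M / (2 * K) * ε) =>
    tsum_stepLaw_exp_le hS hμ harr hr hκ0 hκ1 hdrift hθ0 (hθK θ hθ)
  have hc : 0 < m / M / (2 * K) * ε := by positivity
  obtain ⟨π, hπ, hlim⟩ := exists_isStationary (finite_setOf_exp_smoothNorm_le hc)
    ENNReal.ofReal_ne_top (hbound _ hc le_rfl)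
  refine ⟨π, hπ, fun θ hθ0 hθ => ?_⟩
  refine (expect_mono π fun z => Real.exp_le_exp.2 (mul_le_mul_of_nonneg_left
    (queueNorm_le_smoothNorm (K / (2 * κ)) z) hθ0.le)).trans ?_
  refine (hlim _ _ (fun _ => ENNReal.ofReal_ne_top) (hbound θ hθ0 hθ)).trans_eq ?_
  have hexponent : θ * (4 * K / κ) = θ * (4 * K / (m / M)) / ε := by
    rw [hκ]
    field_simp
  rw [← hexponent]

/-- Polynomial moments from exponential ones: `x ^ p ≤ p! / θ ^ p * e ^ (θ x)`. -/
theorem expect_pow_le {π : PMF (State N)} {θ C : ℝ} (hθ : 0 < θ)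
    (h : expect π (fun z => Real.exp (θ * queueNorm z)) ≤ ENNReal.ofReal C) (p : ℕ) :
    expect π (fun z => queueNorm z ^ p) ≤ ENNReal.ofReal (p.factorial / θ ^ p * C) := by
  have hp : (0 : ℝ) < p.factorial / θ ^ p := by positivity
  refine (expect_mono π (g := fun z => p.factorial / θ ^ p * Real.exp (θ * queueNorm z))
    fun z => ?_).trans ?_
  · have := Real.pow_div_factorial_le_exp _ (mul_nonneg hθ.le (queueNorm_nonneg z)) p
    rw [mul_pow, div_le_iff₀ (by positivity)] at this
    rw [div_mul_eq_mul_div, le_div_iff₀ (by positivity)]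
    linarith
  · rw [expect_const_mul π hp.le, ENNReal.ofReal_mul hp.le]
    gcongr

end JBT

end

theorem lemma2 {N : ℕ} [NeZero N] (svc : Fin N → PMF ℕ) (Smax Amax : ℕ)
    (hS : ∀ n, ∀ k ∈ (svc n).support, k ≤ Smax)
    (hμ : ∀ n, 0 < JBT.mean (svc n)) :
    -- throughput optimality: positive recurrence, a unique steady state, all moments finite
    (∀ r : ℝ, 1 ≤ r → ∀ ε : ℝ, 0 < ε → ∀ arr : PMF ℕ, JBT.IsArrivalLaw svc Amax ε arr →
      JBT.IsPositiveRecurrent (JBT.jbtChain r arr svc hμ) (JBT.emptyState N) ∧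
      ∃ π : PMF (JBT.State N),
        JBT.IsStationary (JBT.jbtChain r arr svc hμ) π ∧
        (∀ π' : PMF (JBT.State N),
          JBT.IsStationary (JBT.jbtChain r arr svc hμ) π' → π' = π) ∧
        ∀ p : ℕ, JBT.expect π (fun z => JBT.queueNorm z ^ p) < ⊤) ∧
    -- the moments in steady state are `O(1 / ε ^ p)`
    (∀ p : ℕ, 1 ≤ p → ∃ M : ℝ, 0 < M ∧
      ∀ r : ℝ, 1 ≤ r → ∀ ε : ℝ, 0 < ε → ∀ arr : PMF ℕ, JBT.IsArrivalLaw svc Amax ε arr →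
      ∀ π : PMF (JBT.State N), JBT.IsStationary (JBT.jbtChain r arr svc hμ) π →
        JBT.expect π (fun z => JBT.queueNorm z ^ p) ≤ ENNReal.ofReal (M / ε ^ p)) ∧
    -- the exponential moment bound in steady state
    (∃ c K₁ K₂ : ℝ, 0 < c ∧ 0 < K₁ ∧ 0 < K₂ ∧
      ∀ r : ℝ, 1 ≤ r → ∀ ε : ℝ, 0 < ε → ∀ arr : PMF ℕ, JBT.IsArrivalLaw svc Amax ε arr →
      ∀ π : PMF (JBT.State N), JBT.IsStationary (JBT.jbtChain r arr svc hμ) π →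
      ∀ θ : ℝ, 0 < θ → θ ≤ c * ε →
        JBT.expect π (fun z => Real.exp (θ * JBT.queueNorm z)) ≤
          ENNReal.ofReal (K₁ * Real.exp (θ * K₂ / ε))) := by
  obtain ⟨c, K₂, hc, hK₂, hmain⟩ := JBT.exists_isStationary_expect_exp_le Amax hS hμ
  -- By uniqueness, the bound passes to every stationary distribution.
  have hexp : ∀ r : ℝ, 1 ≤ r → ∀ ε : ℝ, 0 < ε → ∀ arr : PMF ℕ,
      JBT.IsArrivalLaw svc Amax ε arr → ∀ π : PMF (JBT.State N),
      JBT.IsStationary (JBT.jbtChain r arr svc hμ) π → ∀ θ : ℝ, 0 < θ → θ ≤ c * ε →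
        JBT.expect π (fun z => Real.exp (θ * JBT.queueNorm z)) ≤
          ENNReal.ofReal (7 * Real.exp (θ * K₂ / ε)) := by
    intro r hr ε hε arr harr π hπ
    obtain ⟨σ, hσ, hbound⟩ := hmain r (one_pos.trans_le hr) ε hε arr harr
    rwa [JBT.IsStationary.unique
      (JBT.reaches_emptyState hμ (one_pos.trans_le hr) harr.zero_mem) hσ hπ]
  refine ⟨?_, ?_, c, 7, K₂, hc, by norm_num, hK₂, hexp⟩
  · intro r hr ε hε arr harr
    have hz := JBT.reaches_emptyState hμ (one_pos.trans_le hr) harr.zero_mem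
    obtain ⟨π, hπ, hbound⟩ := hmain r (one_pos.trans_le hr) ε hε arr harr
    refine ⟨hπ.isPositiveRecurrent hz, π, hπ, fun π' hπ' => hπ.unique hz hπ', fun p => ?_⟩
    exact (JBT.expect_pow_le (mul_pos hc hε) (hbound _ (mul_pos hc hε) le_rfl) p).trans_lt
      ENNReal.ofReal_lt_top
  · intro p _
    refine ⟨p.factorial / c ^ p * (7 * Real.exp (c * K₂)), by positivity, ?_⟩
    intro r hr ε hε arr harr π hπ
    refine (JBT.expect_pow_le (mul_pos hc hε)
      (hexp r hr ε hε arr harr π hπ _ (mul_pos hc hε) le_rfl) p).trans_eq ?_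
    congr 1
    rw [show c * ε * K₂ / ε = c * K₂ by field_simp, mul_pow]
    field_simp
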